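/- For $n\ge 2$ let $\Psi_n(x)\in\mathbb{Z}[x]$ be the minimal polynomial of $2\cos(2\pi/n)$, and let $m=\deg\Psi_n$. An element of $\mathbb{Z}[x]/(\Psi_n(x))$ is represented by its $m$ integer coefficients in the power basis $1,x,\dots,x^{m-1}$. A straight-line program is a finite sequence of arithmetic operations (additions, subtractions and multiplications of real numbers), each operand of which is an input, the result of an earlier operation, a rational constant, or a constant $\cos(q\pi)$ with $q\in\mathbb{Q}$; each output is likewise an input, the result of an operation, or such a constant. Theorem. There is an absolute constant $C$ such that for every integer $n\ge 2$ of the form $n=2^r$ or $n=2^r3^s$ with integers $r,s\ge 0$ there is a straight-line program with at most $C\,n\log n$ arithmetic operations which, for all $a(x),b(x)\in\mathbb{Z}[x]/(\Psi_n(x))$, given the coefficients of $a(x)$ and of $b(x)$ in the power basis, outputs the coefficients of the product $a(x)\cdot b(x)\in\mathbb{Z}[x]/(\Psi_n(x))$ in the power basis. -/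

import Mathlib

open scoped Polynomial

/-- `psi n = ζₙ + ζₙ⁻¹ = 2 cos (2π/n)`, the generator of the maximal real subfield of the
`n`-th cyclotomic field. -/
noncomputable def psi (n : ℕ) : ℝ := 2 * Real.cos (2 * Real.pi / n)

theorem isIntegral_psi (n : ℕ) : IsIntegral ℤ (psi n) := by
  have h := Real.isIntegral_two_mul_cos_rat_mul_pi (2 / n : ℚ)
  have e : ((2 / n : ℚ) : ℝ) * Real.pi = 2 * Real.pi / n := by
    push_cast
    ring
  rwa [e] at h

/-- `Ψₙ(x) ∈ ℤ[x]`, the minimal polynomial of `psi n`. -/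
noncomputable def Psi (n : ℕ) : ℤ[X] := minpoly ℤ (psi n)

theorem Psi_monic (n : ℕ) : (Psi n).Monic := minpoly.monic (isIntegral_psi n)

/-- The quotient ring `ℤ[x]/(Ψₙ(x))`. -/
abbrev PsiRing (n : ℕ) : Type := AdjoinRoot (Psi n)

/-- The power basis `1, x, …, x^(m-1)` of `ℤ[x]/(Ψₙ(x))` over `ℤ`, where `m = deg Ψₙ`. -/
noncomputable def psiPowerBasis (n : ℕ) : PowerBasis ℤ (PsiRing n) :=
  AdjoinRoot.powerBasis' (Psi_monic n)

/-- The coefficients of an element of `ℤ[x]/(Ψₙ(x))` in the power basis, as real numbers. -/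
noncomputable def powerCoeffs (n : ℕ) (a : PsiRing n) : Fin (psiPowerBasis n).dim → ℝ :=
  fun i => ((psiPowerBasis n).basis.repr a i : ℝ)

/-! Straight-line programs: the model in which arithmetic operations on real numbers are
counted. -/

/-- What an instruction may read: an input variable, a precomputed constant, which is either a
rational number `q` or the value `cos (q π)` with `q` rational, or the result of the `k`-th
instruction of the program (counted from `0`). -/
inductive Operand (ι : Type) : Type
  | input (i : ι)
  | ratConst (q : ℚ)
  | cosConst (q : ℚ)
  | result (k : ℕ)

/-- The arithmetic operations: addition, subtraction and multiplication. -/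
inductive ArithOp : Type
  | add
  | sub
  | mul

/-- An instruction performs one arithmetic operation on two operands. -/
structure Instruction (ι : Type) : Type where
  op : ArithOp
  left : Operand ι
  right : Operand ι

/-- A straight-line program with input variables indexed by `ι` and outputs indexed by `κ`:
a finite list of instructions, and for each output the place where it is found. -/
structure StraightLineProgram (ι κ : Type) : Type where
  instructions : List (Instruction ι)
  output : κ → Operand ι

/-- The value of an operand on the input `x`, where `res` lists the results computed so far.
(An instruction that is not yet executed has result `0`.) -/
noncomputable def Operand.eval {ι : Type} (x : ι → ℝ) (res : List ℝ) : Operand ι → ℝ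
  | .input i => x i
  | .ratConst q => (q : ℝ)
  | .cosConst q => Real.cos ((q : ℝ) * Real.pi)
  | .result k => res.getD k 0

noncomputable def ArithOp.eval : ArithOp → ℝ → ℝ → ℝ
  | .add, u, v => u + v
  | .sub, u, v => u - v
  | .mul, u, v => u * v

/-- Executing one instruction. -/
noncomputable def Instruction.eval {ι : Type} (x : ι → ℝ) (res : List ℝ)
    (c : Instruction ι) : ℝ :=
  c.op.eval (c.left.eval x res) (c.right.eval x res)

/-- The list of the results of all instructions, executed in order on the input `x`. -/
noncomputable def StraightLineProgram.run {ι κ : Type} (P : StraightLineProgram ι κ)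
    (x : ι → ℝ) : List ℝ :=
  P.instructions.foldl (fun res c => res ++ [c.eval x res]) []

/-- The output of the program on the input `x`. -/
noncomputable def StraightLineProgram.eval {ι κ : Type} (P : StraightLineProgram ι κ)
    (x : ι → ℝ) : κ → ℝ :=
  fun j => (P.output j).eval x (P.run x)

/-- The number of arithmetic operations that the program performs. -/
def StraightLineProgram.numOps {ι κ : Type} (P : StraightLineProgram ι κ) : ℕ :=
  P.instructions.length

/-- The program multiplies in `ℤ[x]/(Ψₙ(x))` in the power basis: from the coefficients of two
elements `a` and `b` it computes the coefficients of `a * b`. -/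
def MultipliesInPowerBasis (n : ℕ)
    (P : StraightLineProgram (Fin (psiPowerBasis n).dim ⊕ Fin (psiPowerBasis n).dim)
      (Fin (psiPowerBasis n).dim)) : Prop :=
  ∀ a b : PsiRing n,
    P.eval (Sum.elim (powerCoeffs n a) (powerCoeffs n b)) = powerCoeffs n (a * b)

/-!
The product in `ℤ[x]/(Ψₙ(x))` is found by multiplying the two representing polynomials of degree
below `m = deg Ψₙ` and reducing modulo `Ψₙ`. Both are done with `O(n log n)` operations on reals.

Polynomials are multiplied by evaluation at the roots of unity of order `2 ^ k` and interpolation,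
with the radix-2 fast Fourier transform (`computes_dft`, `Computes.coeff_mul`). A complex number is
handled as the pair of its real and imaginary parts; the real and imaginary parts of the roots of
unity are admissible constants `cos (qπ)`.

The reduction is Barrett's. The polynomial `H = X ^ (2 * m) /ₘ Ψₙ` does not depend on the input and
has integer coefficients, and the quotient of `f` by `Ψₙ`, for `deg f < 2 * m`, consists of the
coefficients of `f * H` from degree `2 * m` on (`Polynomial.coeff_divByMonic_eq_coeff_mul`). One
more product and a subtraction give the remainder (`Computes.coeff_modByMonic`).

As `2 cos (2π/n)` is a root of `Tₙ(x/2) - 1`, where `Tₙ` is the Chebyshev polynomial, `m ≤ n`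
(`Psi_natDegree_le`), so a transform length `2 ^ k` between `4 * n` and `8 * n` suffices.

Operations are counted for functions of the input: `Computes c S T` says that `c` instructions lead
from the functions in `S` to those in `T`. Functions of the input form a commutative ring, so the
algorithms are statements about polynomials over this ring.
-/

/-! ### Operation counts for sets of functions of the input -/

section Cost

variable {ι : Type}

/-- The results of the instructions `L`, executed in order on the input `x`. -/
noncomputable def execute (L : List (Instruction ι)) (x : ι → ℝ) : List ℝ :=
  L.foldl (fun res c => res ++ [c.eval x res]) []

theorem execute_concat (L : List (Instruction ι)) (c : Instruction ι) (x : ι → ℝ) :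
    execute (L ++ [c]) x = execute L x ++ [c.eval x (execute L x)] := by
  simp [execute, List.foldl_append]

theorem length_execute (L : List (Instruction ι)) (x : ι → ℝ) :
    (execute L x).length = L.length := by
  induction L using List.reverseRecOn with
  | nil => rfl
  | append_singleton L c ih => simp [execute_concat, ih]

theorem execute_prefix_append (L L' : List (Instruction ι)) (x : ι → ℝ) :
    execute L x <+: execute (L ++ L') x := by
  induction L' using List.reverseRecOn with
  | nil => simp
  | append_singleton L' c ih =>
    rw [← List.append_assoc, execute_concat]
    exact ih.trans (List.prefix_append _ _)

/-- The real function `f` of the input can be read off once the instructions `L` have been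
executed, by the same operand however the program goes on. -/
def RealAvailable (L : List (Instruction ι)) (f : (ι → ℝ) → ℝ) : Prop :=
  ∃ o : Operand ι, ∀ L' x, o.eval x (execute (L ++ L') x) = f x

theorem RealAvailable.append {L : List (Instruction ι)} {f : (ι → ℝ) → ℝ}
    (h : RealAvailable L f) (L' : List (Instruction ι)) : RealAvailable (L ++ L') f := by
  obtain ⟨o, ho⟩ := h
  exact ⟨o, fun L'' x => by rw [List.append_assoc, ho]⟩

theorem RealAvailable.op {L : List (Instruction ι)} {f g : (ι → ℝ) → ℝ}
    (hf : RealAvailable L f) (hg : RealAvailable L g) (op : ArithOp) :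
    ∃ c, RealAvailable (L ++ [c]) (fun x => op.eval (f x) (g x)) := by
  obtain ⟨o₁, h₁⟩ := hf
  obtain ⟨o₂, h₂⟩ := hg
  refine ⟨⟨op, o₁, o₂⟩, .result L.length, fun L' x => ?_⟩
  have e₁ := h₁ [] x
  have e₂ := h₂ [] x
  rw [List.append_nil] at e₁ e₂
  obtain ⟨t, ht⟩ := execute_prefix_append (L ++ [⟨op, o₁, o₂⟩]) L' x
  rw [← ht, execute_concat]
  have hl := length_execute L x
  simp only [Instruction.eval, e₁, e₂]
  rw [Operand.eval, List.getD_append _ _ _ _ (by simp [hl]),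
    List.getD_append_right _ _ _ _ (by simp [hl])]
  simp [hl]

/-- A complex function of the input is available if its real and imaginary parts are. -/
def Available (L : List (Instruction ι)) (f : (ι → ℝ) → ℂ) : Prop :=
  RealAvailable L (fun x => (f x).re) ∧ RealAvailable L (fun x => (f x).im)

theorem Available.append {L : List (Instruction ι)} {f : (ι → ℝ) → ℂ}
    (h : Available L f) (L' : List (Instruction ι)) : Available (L ++ L') f :=
  ⟨h.1.append L', h.2.append L'⟩

theorem Available.add {L : List (Instruction ι)} {f g : (ι → ℝ) → ℂ}
    (hf : Available L f) (hg : Available L g) :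
    ∃ L' : List (Instruction ι), L'.length ≤ 2 ∧ Available (L ++ L') (f + g) := by
  obtain ⟨c₁, h₁⟩ := hf.1.op hg.1 .add
  obtain ⟨c₂, h₂⟩ := (hf.2.append [c₁]).op (hg.2.append [c₁]) .add
  exact ⟨[c₁] ++ [c₂], by simp, by rw [← List.append_assoc]; exact ⟨h₁.append _, h₂⟩⟩

theorem Available.sub {L : List (Instruction ι)} {f g : (ι → ℝ) → ℂ}
    (hf : Available L f) (hg : Available L g) :
    ∃ L' : List (Instruction ι), L'.length ≤ 2 ∧ Available (L ++ L') (f - g) := by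
  obtain ⟨c₁, h₁⟩ := hf.1.op hg.1 .sub
  obtain ⟨c₂, h₂⟩ := (hf.2.append [c₁]).op (hg.2.append [c₁]) .sub
  exact ⟨[c₁] ++ [c₂], by simp, by rw [← List.append_assoc]; exact ⟨h₁.append _, h₂⟩⟩

theorem Available.mul {L : List (Instruction ι)} {f g : (ι → ℝ) → ℂ}
    (hf : Available L f) (hg : Available L g) :
    ∃ L' : List (Instruction ι), L'.length ≤ 6 ∧ Available (L ++ L') (f * g) := by
  obtain ⟨c₁, h₁⟩ := hf.1.op hg.1 .mul
  obtain ⟨c₂, h₂⟩ := (hf.2.append [c₁]).op (hg.2.append [c₁]) .mul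
  obtain ⟨c₃, h₃⟩ := (h₁.append [c₂]).op h₂ .sub
  replace hf := ((hf.append [c₁]).append [c₂]).append [c₃]
  replace hg := ((hg.append [c₁]).append [c₂]).append [c₃]
  obtain ⟨c₄, h₄⟩ := hf.1.op hg.2 .mul
  obtain ⟨c₅, h₅⟩ := (hf.2.append [c₄]).op (hg.1.append [c₄]) .mul
  obtain ⟨c₆, h₆⟩ := (h₄.append [c₅]).op h₅ .add
  refine ⟨[c₁] ++ [c₂] ++ [c₃] ++ [c₄] ++ [c₅] ++ [c₆], by simp, ?_⟩
  simp only [← List.append_assoc]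
  exact ⟨((h₃.append _).append _).append _, h₆⟩

theorem available_const_rat (L : List (Instruction ι)) (q : ℚ) :
    Available L (fun _ => (q : ℂ)) :=
  ⟨⟨.ratConst q, fun _ _ => by simp [Operand.eval]⟩,
    ⟨.ratConst 0, fun _ _ => by simp [Operand.eval]⟩⟩

/-- The root of unity `exp (2πiq)`. -/
noncomputable def rootExp (q : ℚ) : ℂ := Complex.exp ((2 * Real.pi * q : ℝ) * Complex.I)

/-- The real and imaginary parts of `exp (2πiq)` are `cos (2qπ)` and `cos ((1/2 - 2q)π)`. -/
theorem available_const_rootExp (L : List (Instruction ι)) (q : ℚ) :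
    Available L (fun _ => rootExp q) := by
  refine ⟨⟨.cosConst (2 * q), fun _ _ => ?_⟩, ⟨.cosConst (1 / 2 - 2 * q), fun _ _ => ?_⟩⟩
  · simp only [Operand.eval, rootExp, Complex.exp_ofReal_mul_I_re]
    congr 1
    push_cast
    ring
  · simp only [Operand.eval, rootExp, Complex.exp_ofReal_mul_I_im]
    rw [← Real.cos_pi_div_two_sub]
    congr 1
    push_cast
    ring

/-- `Computes c S T`: wherever the functions in `S` are available, at most `c` further
instructions make the functions in `T` available. -/
def Computes (c : ℕ) (S T : Set ((ι → ℝ) → ℂ)) : Prop :=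
  ∀ L : List (Instruction ι), (∀ f ∈ S, Available L f) →
    ∃ L' : List (Instruction ι), L'.length ≤ c ∧ ∀ f ∈ T, Available (L ++ L') f

namespace Computes

variable {c d : ℕ} {S T U : Set ((ι → ℝ) → ℂ)} {f g : (ι → ℝ) → ℂ}

theorem mono (h : Computes c S T) (hcd : c ≤ d) (hUT : U ⊆ T) : Computes d S U := by
  intro L hL
  obtain ⟨L', h₁, h₂⟩ := h L hL
  exact ⟨L', h₁.trans hcd, fun f hf => h₂ f (hUT hf)⟩

theorem of_forall_available (h : ∀ L, (∀ f ∈ S, Available L f) → ∀ f ∈ T, Available L f) :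
    Computes 0 S T :=
  fun L hL => ⟨[], by simp, fun f hf => by simpa using h L hL f hf⟩

theorem of_subset (h : T ⊆ S) : Computes 0 S T :=
  of_forall_available fun _ hL f hf => hL f (h hf)

theorem trans (h₁ : Computes c S T) (h₂ : Computes d T U) : Computes (c + d) S U := by
  intro L hL
  obtain ⟨L₁, hc₁, ha₁⟩ := h₁ L hL
  obtain ⟨L₂, hc₂, ha₂⟩ := h₂ _ ha₁
  exact ⟨L₁ ++ L₂, by simp; omega, fun f hf => by simpa using ha₂ f hf⟩

theorem union (h₁ : Computes c S T) (h₂ : Computes d S U) : Computes (c + d) S (T ∪ U) := by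
  intro L hL
  obtain ⟨L₁, hc₁, ha₁⟩ := h₁ L hL
  obtain ⟨L₂, hc₂, ha₂⟩ := h₂ (L ++ L₁) fun f hf => (hL f hf).append _
  refine ⟨L₁ ++ L₂, by simp; omega, ?_⟩
  rintro f (hf | hf)
  · simpa using (ha₁ f hf).append L₂
  · simpa using ha₂ f hf

theorem image_range (F : ℕ → (ι → ℝ) → ℂ) (N : ℕ) (h : ∀ i < N, Computes c S {F i}) :
    Computes (N * c) S (F '' {i | i < N}) := by
  induction N with
  | zero => exact (of_subset (by simp)).mono (by simp) le_rfl
  | succ N ih =>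
    refine ((ih fun i hi => h i (by omega)).union (h N (by omega))).mono (by ring_nf; rfl) ?_
    rintro _ ⟨i, hi, rfl⟩
    rcases Nat.lt_succ_iff_lt_or_eq.mp hi with hi | rfl
    · exact Or.inl ⟨i, hi, rfl⟩
    · exact Or.inr rfl

theorem add (hf : f ∈ S) (hg : g ∈ S) : Computes 2 S {f + g} := by
  intro L hL
  simpa using (hL f hf).add (hL g hg)

theorem sub (hf : f ∈ S) (hg : g ∈ S) : Computes 2 S {f - g} := by
  intro L hL
  simpa using (hL f hf).sub (hL g hg)

theorem mul (hf : f ∈ S) (hg : g ∈ S) : Computes 6 S {f * g} := by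
  intro L hL
  simpa using (hL f hf).mul (hL g hg)

theorem const_rat (q : ℚ) : Computes 0 S {fun _ => (q : ℂ)} :=
  of_forall_available fun L _ f hf => by
    rw [Set.mem_singleton_iff.mp hf]
    exact available_const_rat L q

theorem const_rootExp (q : ℚ) : Computes 0 S {fun _ => rootExp q} :=
  of_forall_available fun L _ f hf => by
    rw [Set.mem_singleton_iff.mp hf]
    exact available_const_rootExp L q

/-- Functions that have been computed may be used along with the given ones. -/
theorem adjoin (h₁ : Computes c S T) (h₂ : Computes d (T ∪ S) U) : Computes (c + d) S U :=
  ((h₁.union (of_subset subset_rfl)).trans h₂).mono (by simp) le_rfl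

theorem mul_const_rat (hf : f ∈ S) (q : ℚ) : Computes 6 S {f * fun _ => (q : ℂ)} :=
  ((const_rat q).adjoin (mul (Or.inr hf) (Or.inl rfl))).mono (by simp) le_rfl

theorem mul_const_rootExp (hf : f ∈ S) (q : ℚ) : Computes 6 S {f * fun _ => rootExp q} :=
  ((const_rootExp q).adjoin (mul (Or.inr hf) (Or.inl rfl))).mono (by simp) le_rfl

end Computes

/-! ### The fast Fourier transform -/

theorem rootExp_add (p q : ℚ) : rootExp (p + q) = rootExp p * rootExp q := by
  rw [rootExp, rootExp, rootExp, ← Complex.exp_add]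
  congr 1
  push_cast
  ring

theorem rootExp_intCast (z : ℤ) : rootExp z = 1 := by
  rw [rootExp, Complex.exp_eq_one_iff]
  exact ⟨z, by push_cast; ring⟩

theorem rootExp_nat_mul (i : ℕ) (q : ℚ) : rootExp (i * q) = rootExp q ^ i := by
  rw [rootExp, rootExp, ← Complex.exp_nat_mul]
  congr 1
  push_cast
  ring

theorem rootExp_eq_one_iff (q : ℚ) : rootExp q = 1 ↔ ∃ z : ℤ, q = z := by
  refine ⟨fun h => ?_, fun ⟨z, hz⟩ => hz ▸ rootExp_intCast z⟩
  rw [rootExp, Complex.exp_eq_one_iff] at h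
  obtain ⟨z, hz⟩ := h
  refine ⟨z, ?_⟩
  have h2 : (2 * (Real.pi : ℂ) * Complex.I) ≠ 0 := Complex.two_pi_I_ne_zero
  have h3 : (q : ℂ) = (z : ℂ) := by
    apply mul_right_cancel₀ h2
    rw [← hz]
    push_cast
    ring
  exact_mod_cast h3

/-- The discrete Fourier transform of length `2 ^ k` of a sequence of complex functions of the
input. The frequency `j` ranges over all integers; only its class modulo `2 ^ k` matters. -/
noncomputable def dft (k : ℕ) (v : ℕ → (ι → ℝ) → ℂ) (j : ℤ) : (ι → ℝ) → ℂ :=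
  ∑ i ∈ Finset.range (2 ^ k), v i * fun _ => rootExp (i * (j / 2 ^ k))

theorem dft_emod (k : ℕ) (v : ℕ → (ι → ℝ) → ℂ) (j : ℤ) : dft k v (j % 2 ^ k) = dft k v j := by
  refine Finset.sum_congr rfl fun i _ => ?_
  have h : ((i : ℚ) * ((j : ℚ) / 2 ^ k)) =
      i * (((j % 2 ^ k : ℤ) : ℚ) / 2 ^ k) + ((i * (j / 2 ^ k) : ℤ) : ℚ) := by
    have := congrArg (Int.cast : ℤ → ℚ) (Int.mul_ediv_add_emod j (2 ^ k))
    push_cast at this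
    push_cast
    rw [← this]
    field_simp
    ring
  rw [h, rootExp_add, rootExp_intCast, mul_one]

theorem Finset.sum_range_two_mul {M : Type*} [AddCommMonoid M] (g : ℕ → M) (n : ℕ) :
    ∑ i ∈ Finset.range (2 * n), g i =
      ∑ i ∈ Finset.range n, g (2 * i) + ∑ i ∈ Finset.range n, g (2 * i + 1) := by
  induction n with
  | zero => simp
  | succ n ih =>
    rw [Finset.sum_range_succ, Finset.sum_range_succ, mul_add, mul_one, Finset.sum_range_succ,
      Finset.sum_range_succ, ih]
    abel

/-- The decimation-in-time step of the Cooley–Tukey algorithm. -/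
theorem dft_succ (k : ℕ) (v : ℕ → (ι → ℝ) → ℂ) (j : ℤ) :
    dft (k + 1) v j = dft k (fun i => v (2 * i)) j +
      dft k (fun i => v (2 * i + 1)) j * fun _ => rootExp (j / 2 ^ (k + 1)) := by
  rw [dft, pow_succ', Finset.sum_range_two_mul, dft, dft, Finset.sum_mul]
  congr 1 <;> refine Finset.sum_congr rfl fun i _ => ?_
  · congr 2
    funext _
    congr 1
    push_cast
    field_simp
    ring
  · rw [mul_assoc]
    congr 1
    funext _
    simp only [Pi.mul_apply]
    rw [← rootExp_add]
    congr 1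
    push_cast
    field_simp
    ring

theorem dft_zero (v : ℕ → (ι → ℝ) → ℂ) (j : ℤ) : dft 0 v j = v 0 := by
  have h := rootExp_intCast 0
  funext x
  simp_all [dft]

/-- Periodicity reduces the computation of all values of a transform to `2 ^ k` of them. -/
theorem Computes.range_dft {c k : ℕ} {S : Set ((ι → ℝ) → ℂ)} {v : ℕ → (ι → ℝ) → ℂ}
    (h : ∀ j : ℤ, Computes c S {dft k v j}) :
    Computes (2 ^ k * c) S (Set.range (dft k v)) := by
  refine (Computes.image_range (fun t : ℕ => dft k v t) (2 ^ k) fun i _ => h i).mono le_rfl ?_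
  rintro _ ⟨j, rfl⟩
  have h0 : 0 ≤ j % 2 ^ k := Int.emod_nonneg _ (by positivity)
  refine ⟨(j % 2 ^ k).toNat, ?_, ?_⟩
  · have := Int.emod_lt_of_pos j (show (0 : ℤ) < 2 ^ k by positivity)
    simp only [Set.mem_ofPred_eq]
    zify
    rwa [Int.toNat_of_nonneg h0]
  · simp only [Int.toNat_of_nonneg h0, dft_emod]

/-- The operation count of the fast Fourier transform. A level costs `8` operations per frequency:
a complex multiplication by a root of unity and a complex addition. -/
theorem computes_dft {S : Set ((ι → ℝ) → ℂ)} (k : ℕ) (v : ℕ → (ι → ℝ) → ℂ)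
    (hv : ∀ i, v i ∈ S) : Computes (8 * k * 2 ^ k) S (Set.range (dft k v)) := by
  induction k generalizing v with
  | zero =>
    refine (Computes.of_subset ?_).mono (Nat.zero_le _) le_rfl
    rintro _ ⟨j, rfl⟩
    rw [dft_zero]
    exact hv 0
  | succ k ih =>
    have h := (ih (fun i => v (2 * i)) fun i => hv _).union
      (ih (fun i => v (2 * i + 1)) fun i => hv _)
    refine (h.trans (Computes.range_dft (c := 8) fun j => ?_)).mono (by rw [pow_succ]; ring_nf; rfl)
      le_rfl
    rw [dft_succ]
    exact ((Computes.mul_const_rootExp (Or.inr ⟨j, rfl⟩) _).adjoin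
      (Computes.add (Or.inr (Or.inl ⟨j, rfl⟩)) (Or.inl rfl))).mono le_rfl le_rfl

/-- Orthogonality of the characters of the cyclic group of order `N`. -/
theorem sum_rootExp (N : ℕ) (hN : 0 < N) (d : ℤ) :
    ∑ t ∈ Finset.range N, rootExp (t * (d / N)) = if (N : ℤ) ∣ d then (N : ℂ) else 0 := by
  have hN' : (N : ℚ) ≠ 0 := by positivity
  simp only [rootExp_nat_mul]
  split_ifs with h
  · obtain ⟨e, rfl⟩ := h
    have : rootExp (((N * e : ℤ) : ℚ) / N) = 1 :=
      (rootExp_eq_one_iff _).mpr ⟨e, by push_cast; field_simp⟩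
    simp only [this, one_pow, Finset.sum_const, Finset.card_range, nsmul_eq_mul, mul_one]
  · have h1 : rootExp ((d : ℚ) / N) ≠ 1 := by
      rw [Ne, rootExp_eq_one_iff]
      rintro ⟨z, hz⟩
      refine h ⟨z, ?_⟩
      rw [div_eq_iff hN'] at hz
      rw [mul_comm]
      exact_mod_cast hz
    have h2 : rootExp ((d : ℚ) / N) ^ N = 1 := by
      rw [← rootExp_nat_mul, mul_div_cancel₀ _ hN', rootExp_intCast]
    rw [geom_sum_eq h1, h2, sub_self, zero_div]

/-- Fourier inversion. -/
theorem dft_dft (k : ℕ) (v : ℕ → (ι → ℝ) → ℂ) (i : ℕ) (hi : i < 2 ^ k) :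
    dft k (fun t => dft k v t) (-i) * (fun _ => (((2 ^ k : ℚ)⁻¹ : ℚ) : ℂ)) = v i := by
  funext x
  have key : ∀ l ∈ Finset.range (2 ^ k), ∑ t ∈ Finset.range (2 ^ k),
      v l x * rootExp (l * ((t : ℤ) / 2 ^ k)) * rootExp (t * ((-i : ℤ) / 2 ^ k)) =
        if l = i then v l x * 2 ^ k else 0 := by
    intro l hl
    have hs := sum_rootExp (2 ^ k) (by positivity) ((l : ℤ) - i)
    have hd : ((2 ^ k : ℕ) : ℤ) ∣ (l : ℤ) - i ↔ l = i := by
      rw [Finset.mem_range] at hl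
      refine ⟨fun h => ?_, fun h => by simp [h]⟩
      have := Int.eq_zero_of_abs_lt_dvd h (by rw [abs_lt]; constructor <;> omega)
      omega
    simp only [hd] at hs
    have e : (if l = i then v l x * 2 ^ k else 0) =
        v l x * if l = i then ((2 ^ k : ℕ) : ℂ) else 0 := by simp
    rw [e, ← hs, Finset.mul_sum]
    refine Finset.sum_congr rfl fun t _ => ?_
    rw [mul_assoc, ← rootExp_add]
    congr 2
    push_cast
    ring
  have h2 : (2 : ℂ) ^ k ≠ 0 := pow_ne_zero _ two_ne_zero
  simp only [dft, Pi.mul_apply, Finset.sum_apply, Finset.sum_mul]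
  rw [Finset.sum_comm]
  simp only [← Finset.sum_mul]
  rw [Finset.sum_congr rfl key]
  simp [Finset.sum_ite_eq', hi, h2]

/-! ### Multiplication and division of polynomials -/

/-- The transform of the coefficients of a polynomial lists its values at the roots of unity of
order `2 ^ k`. -/
theorem dft_coeff (k : ℕ) (p : ((ι → ℝ) → ℂ)[X]) (hp : p.natDegree < 2 ^ k) (j : ℤ) :
    dft k p.coeff j = p.eval (fun _ => rootExp (j / 2 ^ k)) := by
  rw [Polynomial.eval_eq_sum_range' hp, dft]
  refine Finset.sum_congr rfl fun i _ => ?_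
  congr 1
  funext _
  rw [rootExp_nat_mul]
  rfl

/-- The coefficients beyond the degree vanish, so that they are constants and cost nothing. -/
theorem Computes.coeff_of_lt {c : ℕ} {S : Set ((ι → ℝ) → ℂ)} (N : ℕ) (p : ((ι → ℝ) → ℂ)[X])
    (hp : p.natDegree < N) (h : ∀ i < N, Computes c S {p.coeff i}) :
    Computes (N * c) S (Set.range p.coeff) := by
  have h0 := (Computes.image_range p.coeff N h).union (Computes.const_rat (S := S) 0)
  refine h0.mono le_rfl ?_
  rintro _ ⟨i, rfl⟩
  by_cases hi : i < N
  · exact Or.inl ⟨i, hi, rfl⟩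
  · right
    rw [Polynomial.coeff_eq_zero_of_natDegree_lt (by omega)]
    ext
    simp

/-- Polynomial multiplication by transforming, multiplying the values at the roots of unity and
transforming back. -/
theorem Computes.coeff_mul {S : Set ((ι → ℝ) → ℂ)} (k : ℕ) (p q : ((ι → ℝ) → ℂ)[X])
    (hpq : p.natDegree + q.natDegree < 2 ^ k)
    (hp : Set.range p.coeff ⊆ S) (hq : Set.range q.coeff ⊆ S) :
    Computes (24 * k * 2 ^ k + 12 * 2 ^ k) S (Set.range (p * q).coeff) := by
  have hpq' : (p * q).natDegree < 2 ^ k := Polynomial.natDegree_mul_le.trans_lt hpq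
  have h₁ := (computes_dft k p.coeff fun i => hp ⟨i, rfl⟩).union
    (computes_dft k q.coeff fun i => hq ⟨i, rfl⟩)
  have h₂ : Computes (2 ^ k * 6) (Set.range (dft k p.coeff) ∪
      Set.range (dft k q.coeff)) (Set.range (dft k (p * q).coeff)) := by
    refine Computes.range_dft fun j => ?_
    rw [dft_coeff k _ hpq', Polynomial.eval_mul, ← dft_coeff k p (by omega),
      ← dft_coeff k q (by omega)]
    exact Computes.mul (Or.inl ⟨j, rfl⟩) (Or.inr ⟨j, rfl⟩)
  have h₃ := computes_dft (S := Set.range (dft k (p * q).coeff)) k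
    (fun t : ℕ => dft k (p * q).coeff t) fun i =>
      Set.mem_range_self (i : ℤ)
  refine (((h₁.trans h₂).trans h₃).trans
    (Computes.coeff_of_lt (c := 6) (2 ^ k) (p * q) hpq' fun i hi => ?_)).mono
    (le_of_eq (by ring)) le_rfl
  rw [← dft_dft k (p * q).coeff i hi]
  exact Computes.mul_const_rat (Set.mem_range_self _) _

end Cost

open Polynomial in
/-- Barrett reduction: the quotient of `f` by a monic `g` of degree `m` is the part of
`f * (X ^ (2 * m) /ₘ g)` from degree `2 * m` on, if `f` has degree below `2 * m`. -/
theorem Polynomial.coeff_divByMonic_eq_coeff_mul {R : Type*} [CommRing R] {f g : R[X]}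
    (hg : g.Monic) (hf : f.degree < ((2 * g.natDegree : ℕ) : WithBot ℕ)) (i : ℕ) :
    (f /ₘ g).coeff i = (f * (X ^ (2 * g.natDegree) /ₘ g)).coeff (i + 2 * g.natDegree) := by
  nontriviality R
  set m := g.natDegree with hm
  set H := X ^ (2 * m) /ₘ g
  have hgd : g.degree = m := degree_eq_natDegree hg.ne_zero
  have h₁ := modByMonic_add_div f g
  have h₂ := modByMonic_add_div (X ^ (2 * m) : R[X]) g
  have hr := degree_modByMonic_lt f hg
  have hR := degree_modByMonic_lt (X ^ (2 * m) : R[X]) hg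
  set r := f %ₘ g
  set q := f /ₘ g
  set T := (X ^ (2 * m) : R[X]) %ₘ g
  rw [hgd] at hr hR
  -- With `f = q * g + r` and `X ^ (2 * m) = H * g + T`, the error `f * H - q * X ^ (2 * m)`
  -- multiplied by `g` has degree below `3 * m`.
  have e : g * (f * H - q * X ^ (2 * m)) = r * X ^ (2 * m) - f * T := by
    linear_combination f * h₂ - X ^ (2 * m) * h₁
  have hd : (f * H - q * X ^ (2 * m)).degree < ((2 * m : ℕ) : WithBot ℕ) := by
    have h3 : (r * X ^ (2 * m) - f * T).degree < ((m + 2 * m : ℕ) : WithBot ℕ) := by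
      refine (degree_sub_le _ _).trans_lt (max_lt ?_ ?_)
      · refine (degree_mul_le _ _).trans_lt ?_
        rw [degree_X_pow, Nat.cast_add]
        exact WithBot.add_lt_add_right (WithBot.natCast_ne_bot _) hr
      · refine (degree_mul_le _ _).trans_lt ((add_le_add_right hR.le _).trans_lt ?_)
        rw [add_comm, Nat.cast_add]
        exact WithBot.add_lt_add_left (WithBot.natCast_ne_bot _) hf
    rw [← e, hg.degree_mul_comm, hg.degree_mul, hgd, Nat.cast_add, add_comm] at h3
    exact lt_of_add_lt_add_left h3
  have hc := coeff_eq_zero_of_degree_lt (hd.trans_le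
    (Nat.cast_le.mpr (Nat.le_add_left (2 * m) i)))
  rw [coeff_sub, coeff_mul_X_pow, sub_eq_zero] at hc
  exact hc.symm

section Reduction

variable {ι : Type}

theorem Computes.coeff_map_intCast {S : Set ((ι → ℝ) → ℂ)} (p : ℤ[X]) :
    Computes 0 S (Set.range (p.map (Int.castRingHom ((ι → ℝ) → ℂ))).coeff) := by
  refine Computes.of_forall_available ?_
  rintro L _ _ ⟨i, rfl⟩
  rw [Polynomial.coeff_map]
  simpa using! available_const_rat L (p.coeff i : ℚ)

/-- Division with remainder by a fixed monic integer polynomial costs two multiplications and a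
subtraction, because the auxiliary quotient in Barrett reduction has constant coefficients. -/
theorem Computes.coeff_modByMonic {S : Set ((ι → ℝ) → ℂ)} (k : ℕ) {g : ℤ[X]} (hg : g.Monic)
    (hm : 0 < g.natDegree) (hk : 4 * g.natDegree ≤ 2 ^ k) (f : ((ι → ℝ) → ℂ)[X])
    (hf : f.natDegree < 2 * g.natDegree) (hS : Set.range f.coeff ⊆ S) :
    Computes (2 * (24 * k * 2 ^ k + 12 * 2 ^ k) + 2 ^ k * 2) S
      (Set.range (f %ₘ g.map (Int.castRingHom ((ι → ℝ) → ℂ))).coeff) := by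
  set φ := Int.castRingHom ((ι → ℝ) → ℂ)
  set m := g.natDegree with hmdef
  have hG : (g.map φ).Monic := hg.map φ
  have hGm : (g.map φ).natDegree = m := hg.natDegree_map φ
  have hHdef : (Polynomial.X ^ (2 * m) /ₘ g).map φ = Polynomial.X ^ (2 * m) /ₘ g.map φ := by
    rw [Polynomial.map_divByMonic φ hg, Polynomial.map_pow, Polynomial.map_X]
  have hHm : (Polynomial.X ^ (2 * m) /ₘ g.map φ).natDegree = m := by
    rw [Polynomial.natDegree_divByMonic _ hG, Polynomial.natDegree_X_pow, hGm]
    omega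
  -- The quotient `f /ₘ g` is a segment of the coefficients of `f * (X ^ (2 * m) /ₘ g)`.
  have hbarrett := Polynomial.coeff_divByMonic_eq_coeff_mul (f := f) hG (by
    rw [hGm]
    exact Polynomial.degree_le_natDegree.trans_lt (by exact_mod_cast hf))
  rw [hGm] at hbarrett
  have hQm : (f /ₘ g.map φ).natDegree < m := by
    rw [Polynomial.natDegree_divByMonic _ hG, hGm]
    omega
  have hRm : (f %ₘ g.map φ).natDegree < m := by
    rw [← hGm]
    refine Polynomial.natDegree_modByMonic_lt _ hG fun h => ?_
    rw [h, Polynomial.natDegree_one] at hGm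
    omega
  have h₁ : Computes (24 * k * 2 ^ k + 12 * 2 ^ k) S (Set.range (f /ₘ g.map φ).coeff) := by
    have hH := Computes.coeff_map_intCast (S := S) (Polynomial.X ^ (2 * m) /ₘ g)
    rw [hHdef] at hH
    refine (hH.adjoin (Computes.coeff_mul k f _ (by omega)
      (hS.trans Set.subset_union_right) Set.subset_union_left)).mono (by omega) ?_
    rintro _ ⟨i, rfl⟩
    exact ⟨i + 2 * m, (hbarrett i).symm⟩
  have h₂ : Computes (24 * k * 2 ^ k + 12 * 2 ^ k) (Set.range (f /ₘ g.map φ).coeff ∪ S)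
      (Set.range (g.map φ * (f /ₘ g.map φ)).coeff) :=
    ((Computes.coeff_map_intCast g).adjoin (Computes.coeff_mul k (g.map φ) _ (by omega)
      Set.subset_union_left (Set.subset_union_left.trans Set.subset_union_right))).mono
      (by omega) le_rfl
  refine ((h₁.adjoin h₂).adjoin (Computes.coeff_of_lt (c := 2) (2 ^ k) _ (by omega)
    fun i _ => ?_)).mono (by omega) le_rfl
  rw [Polynomial.modByMonic_eq_sub_mul_div, Polynomial.coeff_sub]
  exact Computes.sub (Or.inr (hS ⟨i, rfl⟩)) (Or.inl ⟨i, rfl⟩)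

/-- The polynomial whose coefficients are the inputs `e 0, …, e (m - 1)`. -/
noncomputable def inputPolynomial {m : ℕ} (e : Fin m → ι) : ((ι → ℝ) → ℂ)[X] :=
  ∑ i : Fin m, Polynomial.C (fun x => (x (e i) : ℂ)) * Polynomial.X ^ (i : ℕ)

theorem natDegree_inputPolynomial_lt {m : ℕ} (hm : 0 < m) (e : Fin m → ι) :
    (inputPolynomial e).natDegree < m := by
  rcases eq_or_ne (inputPolynomial e) 0 with h | h
  · rwa [h, Polynomial.natDegree_zero]
  · exact (Polynomial.natDegree_lt_iff_degree_lt h).mpr (Polynomial.degree_sum_fin_lt _)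

theorem coeff_inputPolynomial {m : ℕ} (e : Fin m → ι) (j : ℕ) :
    (inputPolynomial e).coeff j =
      if h : j < m then (fun x => (x (e ⟨j, h⟩) : ℂ) : (ι → ℝ) → ℂ) else 0 := by
  simp only [inputPolynomial, Polynomial.finsetSum_coeff, Polynomial.coeff_C_mul_X_pow]
  split_ifs with h
  · rw [Finset.sum_eq_single ⟨j, h⟩]
    · simp
    · intro b _ hb
      exact if_neg fun hj => hb (Fin.ext hj.symm)
    · simp
  · exact Finset.sum_eq_zero fun i _ => if_neg (by omega)

theorem available_coeff_inputPolynomial (L : List (Instruction ι)) {m : ℕ} (e : Fin m → ι)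
    (j : ℕ) : Available L ((inputPolynomial e).coeff j) := by
  rw [coeff_inputPolynomial]
  split_ifs with h
  · exact ⟨⟨.input (e ⟨j, h⟩), fun _ _ => by simp [Operand.eval]⟩,
      ⟨.ratConst 0, fun _ _ => by simp [Operand.eval]⟩⟩
  · simpa using! available_const_rat L 0

/-- On the input given by the coefficients of `p`, the generic polynomial becomes `p`. -/
theorem map_inputPolynomial {m : ℕ} (e : Fin m → ι) (x : ι → ℝ) (p : ℤ[X])
    (hp : p.degree < (m : WithBot ℕ)) (h : ∀ i : Fin m, x (e i) = p.coeff i) :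
    (inputPolynomial e).map (Pi.evalRingHom (fun _ => ℂ) x) = p.map (Int.castRingHom ℂ) := by
  ext j
  rw [Polynomial.coeff_map, Polynomial.coeff_map, coeff_inputPolynomial]
  split_ifs with hj
  · simp [h ⟨j, hj⟩]
  · rw [Polynomial.coeff_eq_zero_of_degree_lt (hp.trans_le (by exact_mod_cast not_lt.mp hj))]
    simp

end Reduction

/-! ### Multiplication in the power basis -/

theorem Psi_natDegree_pos (n : ℕ) : 0 < (Psi n).natDegree :=
  minpoly.natDegree_pos (isIntegral_psi n)

/-- The degree of `Ψₙ` is at most `n`, because `2 cos (2π/n)` is a root of `Tₙ(x/2) - 1`. -/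
theorem Psi_natDegree_le (n : ℕ) (hn : 0 < n) : (Psi n).natDegree ≤ n := by
  set p : ℚ[X] := (Polynomial.Chebyshev.T ℚ n).comp (Polynomial.C (1 / 2) * Polynomial.X) -
    Polynomial.C 1 with hpdef
  have hp : p.natDegree = n := by
    rw [hpdef, Polynomial.natDegree_sub_C, Polynomial.natDegree_comp,
      Polynomial.natDegree_C_mul_X _ (by norm_num)]
    simp
  have hroot : Polynomial.aeval (psi n) p = 0 := by
    have hn' : (n : ℝ) ≠ 0 := by positivity
    have h := Polynomial.Chebyshev.T_real_cos (2 * Real.pi / n) n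
    rw [Int.cast_natCast, mul_div_cancel₀ _ hn', Real.cos_two_pi] at h
    rw [hpdef, map_sub, Polynomial.aeval_comp, Polynomial.aeval_C, map_one, sub_eq_zero, map_mul,
      Polynomial.aeval_C, Polynomial.aeval_X, Polynomial.Chebyshev.aeval_T, ← h, psi]
    congr 1
    simp
  have hp0 : p ≠ 0 := by
    intro h
    rw [h, Polynomial.natDegree_zero] at hp
    omega
  have hle := Polynomial.natDegree_le_natDegree (minpoly.degree_le_of_ne_zero ℚ (psi n) hp0 hroot)
  rw [minpoly.isIntegrallyClosed_eq_field_fractions' ℚ (isIntegral_psi n),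
    (minpoly.monic (isIntegral_psi n)).natDegree_map, hp] at hle
  exact hle

theorem powerCoeffs_eq_coeff (n : ℕ) (a : PsiRing n) (i : Fin (psiPowerBasis n).dim) :
    powerCoeffs n a i = ((AdjoinRoot.modByMonicHom (Psi_monic n) a).coeff i : ℝ) :=
  rfl

theorem modByMonicHom_mul (n : ℕ) (a b : PsiRing n) :
    AdjoinRoot.modByMonicHom (Psi_monic n) (a * b) =
      (AdjoinRoot.modByMonicHom (Psi_monic n) a * AdjoinRoot.modByMonicHom (Psi_monic n) b) %ₘ
        Psi n := by
  have hl := AdjoinRoot.mk_leftInverse (Psi_monic n)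
  rw [← AdjoinRoot.modByMonicHom_mk (Psi_monic n), map_mul (AdjoinRoot.mk (Psi n)), hl, hl]

theorem degree_modByMonicHom_lt (n : ℕ) (a : PsiRing n) :
    (AdjoinRoot.modByMonicHom (Psi_monic n) a).degree < ((psiPowerBasis n).dim : WithBot ℕ) := by
  obtain ⟨p, rfl⟩ := AdjoinRoot.mk_surjective a
  rw [AdjoinRoot.modByMonicHom_mk]
  exact (Polynomial.degree_modByMonic_lt p (Psi_monic n)).trans_le
    Polynomial.degree_le_natDegree

/-- Multiplication modulo `Ψₙ` by a transform of length `2 ^ k`: three products of polynomials,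
one for `a * b` and two for its reduction. -/
theorem exists_multipliesInPowerBasis (n k : ℕ) (hk : 4 * (Psi n).natDegree ≤ 2 ^ k) :
    ∃ P : StraightLineProgram (Fin (psiPowerBasis n).dim ⊕ Fin (psiPowerBasis n).dim)
        (Fin (psiPowerBasis n).dim),
      MultipliesInPowerBasis n P ∧ P.numOps ≤ 72 * k * 2 ^ k + 38 * 2 ^ k := by
  have hm := Psi_natDegree_pos n
  have hdim : (psiPowerBasis n).dim = (Psi n).natDegree := rfl
  set ι := Fin (psiPowerBasis n).dim ⊕ Fin (psiPowerBasis n).dim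
  set A : ((ι → ℝ) → ℂ)[X] := inputPolynomial Sum.inl
  set B : ((ι → ℝ) → ℂ)[X] := inputPolynomial Sum.inr
  have hA : A.natDegree < (Psi n).natDegree := natDegree_inputPolynomial_lt hm _
  have hB : B.natDegree < (Psi n).natDegree := natDegree_inputPolynomial_lt hm _
  have hAB : (A * B).natDegree < 2 * (Psi n).natDegree :=
    Polynomial.natDegree_mul_le.trans_lt (by omega)
  have h₁ := Computes.coeff_mul (S := Set.range A.coeff ∪ Set.range B.coeff) k A B (by omega)
    Set.subset_union_left Set.subset_union_right
  have h₂ := h₁.trans (Computes.coeff_modByMonic k (Psi_monic n) hm hk (A * B) hAB subset_rfl)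
  obtain ⟨L, hL, hav⟩ := h₂ [] (by
    rintro _ (⟨i, rfl⟩ | ⟨i, rfl⟩) <;> exact available_coeff_inputPolynomial _ _ _)
  have ho : ∀ i : Fin (psiPowerBasis n).dim, ∃ o : Operand ι, ∀ x, o.eval x (execute L x) =
      (((A * B) %ₘ (Psi n).map (Int.castRingHom ((ι → ℝ) → ℂ))).coeff i x).re := by
    intro i
    obtain ⟨o, ho⟩ := (hav _ ⟨(i : ℕ), rfl⟩).1
    exact ⟨o, fun x => by simpa using ho [] x⟩
  choose o ho using ho
  refine ⟨⟨L, o⟩, fun a b => funext fun i => ?_, ?_⟩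
  · -- Evaluation at the input `x` is a ring homomorphism, and it carries the polynomials computed
    -- by the program to those attached to `a` and `b`.
    set x : ι → ℝ := Sum.elim (powerCoeffs n a) (powerCoeffs n b)
    refine (ho i x).trans ?_
    have hmap : (((A * B) %ₘ (Psi n).map (Int.castRingHom ((ι → ℝ) → ℂ))).map
        (Pi.evalRingHom (fun _ => ℂ) x)) =
          (AdjoinRoot.modByMonicHom (Psi_monic n) (a * b)).map (Int.castRingHom ℂ) := by
      rw [modByMonicHom_mul, Polynomial.map_modByMonic _ ((Psi_monic n).map _),
        Polynomial.map_modByMonic _ (Psi_monic n), Polynomial.map_mul, Polynomial.map_mul,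
        Polynomial.map_map,
        map_inputPolynomial Sum.inl x _ (degree_modByMonicHom_lt n a)
          (powerCoeffs_eq_coeff n a),
        map_inputPolynomial Sum.inr x _ (degree_modByMonicHom_lt n b)
          (powerCoeffs_eq_coeff n b)]
      congr 2
    have hc := congrArg (fun p => (p.coeff (i : ℕ)).re) hmap
    simpa [Polynomial.coeff_map, powerCoeffs_eq_coeff] using hc
  · simp only [StraightLineProgram.numOps]
    exact hL.trans (le_of_eq (by ring))

theorem mainTheorem2 :
    ∃ C : ℝ, ∀ n : ℕ, 2 ≤ n → (∃ r s : ℕ, n = 2 ^ r * 3 ^ s) →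
      ∃ P : StraightLineProgram (Fin (psiPowerBasis n).dim ⊕ Fin (psiPowerBasis n).dim)
          (Fin (psiPowerBasis n).dim),
        MultipliesInPowerBasis n P ∧ (P.numOps : ℝ) ≤ C * (n * Real.log n) := by
  refine ⟨3520 / Real.log 2, fun n hn _ => ?_⟩
  -- The transform length `2 ^ k` lies between `4 * n` and `8 * n`.
  set l := Nat.log 2 n
  have hl₁ : 2 ^ l ≤ n := Nat.pow_log_le_self 2 (by omega)
  have hl₂ : n < 2 ^ (l + 1) := Nat.lt_pow_succ_log_self (by norm_num) n
  have hl₃ : 1 ≤ l := Nat.log_pos (by norm_num) hn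
  rw [pow_succ] at hl₂
  have hpow : 2 ^ (l + 3) = 8 * 2 ^ l := by ring
  have hdeg := Psi_natDegree_le n (by omega)
  obtain ⟨P, hP, hops⟩ := exists_multipliesInPowerBasis n (l + 3) (by omega)
  refine ⟨P, hP, ?_⟩
  have hbound : P.numOps ≤ 3520 * (n * l) := by
    refine hops.trans ?_
    rw [hpow]
    have h : 72 * (l + 3) + 38 ≤ 440 * l := by omega
    calc 72 * (l + 3) * (8 * 2 ^ l) + 38 * (8 * 2 ^ l) = (72 * (l + 3) + 38) * (8 * 2 ^ l) := by
          ring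
      _ ≤ 440 * l * (8 * n) := by gcongr
      _ = 3520 * (n * l) := by ring
  have hlog2 : 0 < Real.log 2 := Real.log_pos (by norm_num)
  have hlog : l * Real.log 2 ≤ Real.log n := by
    rw [← Real.log_pow]
    exact Real.log_le_log (by positivity) (by exact_mod_cast hl₁)
  calc (P.numOps : ℝ) ≤ 3520 * (n * l) := by exact_mod_cast hbound
    _ = 3520 / Real.log 2 * (n * (l * Real.log 2)) := by field_simp
    _ ≤ 3520 / Real.log 2 * (n * Real.log n) := by gcongr
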